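/- Let $x_{m,j}$ ($m,j\ge 1$) be indeterminates, where $x_{m,j}$ has degree $m$, and let $\mathsf{P\Lambda}$ be the $\mathbb{Q}$-algebra of polysymmetric functions: the formal infinite $\mathbb{Q}$-linear combinations of monomials in the $x_{m,j}$, of bounded degree, that for each fixed $m$ are unchanged by every permutation of the variables $x_{m,1},x_{m,2},\dots$. A stack $d^m$ is a pair $(d,m)$ of positive integers; stacks are ordered lexicographically. A stack partition of $n$ (written $\tau\Vdash n$) is a finite weakly decreasing sequence of stacks $\tau=(d_1^{m_1},\dots,d_s^{m_s})$ with $d_1m_1+\dots+d_sm_s=n$; put $\operatorname{sgn}(\tau)=(-1)^{m_1+\dots+m_s}$. Write $\tau\vdash n$ if moreover all $m_i=1$. Let $M_\tau\in\mathsf{P\Lambda}$ be the sum of all distinct monomials of the form $x_{d_1,\alpha_1}^{m_1}\cdots x_{d_s,\alpha_s}^{m_s}$, each with coefficient $1$, where $\alpha_1,\dots,\alpha_s$ are positive integers with $\alpha_i\neq\alpha_j$ whenever $i\ne j$ and $d_i=d_j$. For $d,m\ge1$ define $$E^+_d=\sum_{\alpha\vdash d}M_\alpha,\qquad H^+_d=\sum_{\alpha\Vdash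 d}\operatorname{sgn}(\alpha)M_\alpha,$$ let $E^+_{d^m}$ and $H^+_{d^m}$ be obtained from $E^+_d$ and $H^+_d$ by replacing every variable $x_{i,j}$ by $x_{i,j}^m$, and for a stack partition $\tau=(d_1^{m_1},\dots,d_s^{m_s})$ let $H^+_\tau=\prod_{i=1}^s H^+_{d_i^{m_i}}$. Theorem. There is exactly one ring endomorphism $\Omega$ of $\mathsf{P\Lambda}$ with $\Omega(E^+_{d^m})=H^+_{d^m}$ for all $d,m\ge1$, and it is an involution: $\Omega\circ\Omega=\mathrm{id}$. Corollary. The family $(H^+_{d^m})_{d,m\ge1}$ is an algebraic basis of $\mathsf{P\Lambda}$: it is algebraically independent over $\mathbb{Q}$ and generates $\mathsf{P\Lambda}$ as a $\mathbb{Q}$-algebra. The family $(H^+_\tau)$, indexed by all stack partitions $\tau$, is a linear basis of $\mathsf{P\Lambda}$ over $\mathbb{Q}$. -/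

import Mathlib

noncomputable section

namespace Polysymmetric

/-! ### Stacks and stack partitions -/

/-- A stack `d^m` is a pair `(d, m)` of positive integers, with `d` its degree and `m` its
multiplicity. Stacks are ordered lexicographically: first by degree, then by multiplicity. -/
abbrev Stack : Type := ℕ+ ×ₗ ℕ+

/-- The degree `d` of the stack `d^m`. -/
def Stack.deg (s : Stack) : ℕ+ := (ofLex s).1

/-- The multiplicity `m` of the stack `d^m`. -/
def Stack.mult (s : Stack) : ℕ+ := (ofLex s).2

/-- A stack partition is a (finite) weakly decreasing sequence of stacks. -/
@[ext]
structure StackPartition where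
  /-- The sequence of stacks `d_1^{m_1}, …, d_s^{m_s}`. -/
  parts : List Stack
  /-- The sequence is weakly decreasing. -/
  sorted : parts.SortedGE

namespace StackPartition

/-- The size `|τ| = d_1 m_1 + ⋯ + d_s m_s`. -/
def size (τ : StackPartition) : ℕ :=
  (τ.parts.map fun s => (s.deg : ℕ) * (s.mult : ℕ)).sum

/-- The area of `τ`: the sum `m_1 + ⋯ + m_s` of its multiplicities. -/
def area (τ : StackPartition) : ℕ :=
  (τ.parts.map fun s => (s.mult : ℕ)).sum

/-- The sign `(-1)^{area(τ)}`, as a rational number. -/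
def sgn (τ : StackPartition) : ℚ := (-1) ^ τ.area

/-- All multiplicities of `τ` equal `1`, i.e. `τ` is an ordinary partition. -/
def IsOrdinary (τ : StackPartition) : Prop := ∀ s ∈ τ.parts, s.mult = 1

theorem length_le_sum (l : List Stack) :
    l.length ≤ (l.map fun s => (s.deg : ℕ) * (s.mult : ℕ)).sum := by
  induction l with
  | nil => simp
  | cons s l ih =>
    have : 0 < (s.deg : ℕ) * (s.mult : ℕ) := Nat.mul_pos s.deg.pos s.mult.pos
    simp only [List.length_cons, List.map_cons, List.sum_cons]
    omega

/-- There are only finitely many stack partitions of `n`. -/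
theorem finite_size_eq (n : ℕ) : {τ : StackPartition | τ.size = n}.Finite := by
  have hS : (Set.univ : Set (Set.Icc (1 : ℕ+) n.succPNat × Set.Icc (1 : ℕ+) n.succPNat)).Finite :=
    Set.finite_univ
  let f : (Set.Icc (1 : ℕ+) n.succPNat × Set.Icc (1 : ℕ+) n.succPNat) → Stack :=
    fun p => toLex (p.1.1, p.2.1)
  have hfin := (List.finite_length_le
    (Set.Icc (1 : ℕ+) n.succPNat × Set.Icc (1 : ℕ+) n.succPNat) n).image (List.map f)
  refine Set.Finite.of_finite_image (f := parts) (hfin.subset ?_)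
    (fun a _ b _ h => StackPartition.ext h)
  rintro _ ⟨τ, hτ, rfl⟩
  have hτ' : τ.size = n := hτ
  have hlen : τ.parts.length ≤ n := hτ' ▸ length_le_sum τ.parts
  have hmem : ∀ s ∈ τ.parts, s ∈ Set.range f := by
    intro s hs
    have h1 : (s.deg : ℕ) * (s.mult : ℕ) ≤ n := by
      rw [← hτ']
      exact List.single_le_sum (by simp) _ (List.mem_map_of_mem hs)
    have hd := s.deg.pos
    have hm := s.mult.pos
    have h2 : (s.deg : ℕ) ≤ n + 1 := by nlinarith
    have h3 : (s.mult : ℕ) ≤ n + 1 := by nlinarith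
    exact ⟨(⟨s.deg, one_le, h2⟩, ⟨s.mult, one_le, h3⟩), rfl⟩
  obtain ⟨l, hl⟩ : ∃ l, List.map f l = τ.parts := by
    have : τ.parts ∈ Set.range (List.map f) := by
      rw [Set.range_list_map]
      exact hmem
    exact this
  refine ⟨l, ?_, hl⟩
  have := congrArg List.length hl
  simp only [List.length_map] at this
  simpa [this] using hlen

/-- The finite set of all stack partitions of `n`. -/
def ofSize (n : ℕ) : Finset StackPartition := (finite_size_eq n).toFinset

end StackPartition

/-! ### The algebra of polysymmetric functions -/

/-- The variables `x_{m,j}`, for `m, j ≥ 1`. -/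
abbrev Var : Type := ℕ+ × ℕ+

/-- The degree of the monomial with exponent vector `n`, where `x_{m,j}` has degree `m`. -/
def wdeg : (Var →₀ ℕ) →+ ℕ := Finsupp.weight fun v : Var => (v.1 : ℕ)

/-- The permutation of the variables that sends `x_{m,j}` to `x_{m,σ j}` for the given `m`, and
fixes `x_{m',j}` for all `m' ≠ m`. -/
abbrev rowPerm (m : ℕ+) (σ : Equiv.Perm ℕ+) : Equiv.Perm Var := Equiv.Perm.prodExtendRight m σ

/-- The `ℚ`-algebra `PΛ` of polysymmetric functions: formal series of bounded degree in the
variables `x_{m,j}` that for each fixed `m` remain unchanged by every permutation of the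
variables `x_{m,1}, x_{m,2}, …`. -/
def PLambda : Subalgebra ℚ (MvPowerSeries Var ℚ) where
  carrier := {f | (∃ N : ℕ, ∀ n : Var →₀ ℕ, MvPowerSeries.coeff n f ≠ 0 → wdeg n ≤ N) ∧
    ∀ (m : ℕ+) (σ : Equiv.Perm ℕ+), MvPowerSeries.renameEquiv ℚ (rowPerm m σ) f = f}
  mul_mem' := by
    classical
    rintro f g ⟨⟨N, hN⟩, hf⟩ ⟨⟨K, hK⟩, hg⟩
    refine ⟨⟨N + K, fun n hn => ?_⟩, fun m σ => by rw [map_mul, hf, hg]⟩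
    rw [MvPowerSeries.coeff_mul] at hn
    obtain ⟨p, hp, hne⟩ := Finset.exists_ne_zero_of_sum_ne_zero hn
    rw [← Finset.HasAntidiagonal.mem_antidiagonal.1 hp, map_add]
    exact add_le_add (hN _ (left_ne_zero_of_mul hne)) (hK _ (right_ne_zero_of_mul hne))
  add_mem' := by
    rintro f g ⟨⟨N, hN⟩, hf⟩ ⟨⟨K, hK⟩, hg⟩
    refine ⟨⟨max N K, fun n hn => ?_⟩, fun m σ => by rw [map_add, hf, hg]⟩
    rw [map_add] at hn
    by_cases h : MvPowerSeries.coeff n f = 0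
    · exact le_max_of_le_right (hK n (by simpa [h] using hn))
    · exact le_max_of_le_left (hN n h)
  algebraMap_mem' := by
    classical
    intro r
    refine ⟨⟨0, fun n hn => ?_⟩, fun m σ => AlgEquiv.commutes _ r⟩
    rw [MvPowerSeries.algebraMap_apply, MvPowerSeries.coeff_C] at hn
    have : n = 0 := by
      by_contra h
      simp [h] at hn
    simp [this]

theorem mem_PLambda_iff (f : MvPowerSeries Var ℚ) : f ∈ PLambda ↔
    (∃ N : ℕ, ∀ n : Var →₀ ℕ, MvPowerSeries.coeff n f ≠ 0 → wdeg n ≤ N) ∧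
    ∀ (m : ℕ+) (σ : Equiv.Perm ℕ+), MvPowerSeries.renameEquiv ℚ (rowPerm m σ) f = f := Iff.rfl

/-- Invariance under a permutation of the variables, read off the coefficients. -/
theorem renameEquiv_eq_self_iff (e : Equiv.Perm Var) (f : MvPowerSeries Var ℚ) :
    MvPowerSeries.renameEquiv ℚ e f = f ↔
    ∀ n : Var →₀ ℕ,
      MvPowerSeries.coeff (Finsupp.embDomain e.toEmbedding n) f = MvPowerSeries.coeff n f := by
  have key : ∀ n : Var →₀ ℕ, MvPowerSeries.coeff (Finsupp.embDomain e.toEmbedding n)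
      (MvPowerSeries.renameEquiv ℚ e f) = MvPowerSeries.coeff n f := fun n =>
    MvPowerSeries.coeff_embDomain_rename e.toEmbedding f n
  constructor
  · intro h n
    rw [← key n, h]
  · intro h
    ext n
    obtain ⟨k, rfl⟩ : ∃ k, Finsupp.embDomain e.toEmbedding k = n :=
      ⟨Finsupp.embDomain e.symm.toEmbedding n, by
        ext v
        obtain ⟨w, rfl⟩ := e.surjective v
        have h1 := Finsupp.embDomain_apply_self e.toEmbedding
          (Finsupp.embDomain e.symm.toEmbedding n) w
        have h2 := Finsupp.embDomain_apply_self e.symm.toEmbedding n (e w)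
        simp only [Equiv.coe_toEmbedding, Equiv.symm_apply_apply] at h1 h2
        rw [h1, h2]⟩
    rw [key, h]

/-! ### Monomial polysymmetric functions -/

/-- The monomial `x_{d_1,α_1}^{m_1} ⋯ x_{d_s,α_s}^{m_s}` (as an exponent vector) attached to
`τ = (d_1^{m_1}, …, d_s^{m_s})` and a sequence `α` of positive integers. -/
def stackMonomial (τ : StackPartition) (α : Fin τ.parts.length → ℕ+) : Var →₀ ℕ :=
  ∑ i, Finsupp.single ((τ.parts.get i).deg, α i) ((τ.parts.get i).mult : ℕ)

/-- The sequences `α` allowed for `τ`: `α_i ≠ α_j` whenever `i ≠ j` and `d_i = d_j`. -/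
def Admissible (τ : StackPartition) (α : Fin τ.parts.length → ℕ+) : Prop :=
  ∀ i j, i ≠ j → (τ.parts.get i).deg = (τ.parts.get j).deg → α i ≠ α j

open Classical in
/-- The monomial polysymmetric function `M_τ` as a formal series: the sum of all (distinct)
monomials `x_{d_1,α_1}^{m_1} ⋯ x_{d_s,α_s}^{m_s}` with `α` admissible, each with
coefficient `1`. -/
def monomialSeries (τ : StackPartition) : MvPowerSeries Var ℚ := fun n =>
  if ∃ α, Admissible τ α ∧ n = stackMonomial τ α then 1 else 0

theorem coeff_monomialSeries_of_exists (τ : StackPartition) (n : Var →₀ ℕ)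
    (h : ∃ α, Admissible τ α ∧ n = stackMonomial τ α) :
    MvPowerSeries.coeff n (monomialSeries τ) = 1 := if_pos h

theorem coeff_monomialSeries_of_not_exists (τ : StackPartition) (n : Var →₀ ℕ)
    (h : ¬ ∃ α, Admissible τ α ∧ n = stackMonomial τ α) :
    MvPowerSeries.coeff n (monomialSeries τ) = 0 := if_neg h

theorem wdeg_stackMonomial (τ : StackPartition) (α : Fin τ.parts.length → ℕ+) :
    wdeg (stackMonomial τ α) = τ.size := by
  rw [stackMonomial, map_sum, StackPartition.size, ← Fin.sum_univ_fun_getElem]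
  refine Finset.sum_congr rfl fun i _ => ?_
  rw [wdeg, Finsupp.weight_single, smul_eq_mul, mul_comm]
  rfl

theorem exists_admissible_perm (τ : StackPartition) (m : ℕ+) (σ : Equiv.Perm ℕ+)
    (n : Var →₀ ℕ) (h : ∃ α, Admissible τ α ∧ n = stackMonomial τ α) :
    ∃ α, Admissible τ α ∧
      Finsupp.embDomain (rowPerm m σ).toEmbedding n = stackMonomial τ α := by
  obtain ⟨α, hα, rfl⟩ := h
  refine ⟨fun i => (rowPerm m σ ((τ.parts.get i).deg, α i)).2, ?_, ?_⟩
  · intro i j hij hd h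
    refine hα i j hij hd ?_
    have h1 : rowPerm m σ ((τ.parts.get i).deg, α i) =
        rowPerm m σ ((τ.parts.get j).deg, α j) := by
      refine Prod.ext ?_ h
      rw [Equiv.Perm.fst_prodExtendRight, Equiv.Perm.fst_prodExtendRight]
      exact hd
    exact congrArg Prod.snd ((rowPerm m σ).injective h1)
  · rw [Finsupp.embDomain_eq_mapDomain, stackMonomial, stackMonomial,
      Finsupp.mapDomain_finsetSum]
    refine Finset.sum_congr rfl fun i _ => ?_
    rw [Finsupp.mapDomain_single]
    congr 1
    exact Prod.ext (Equiv.Perm.fst_prodExtendRight _ _ _) rfl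

theorem monomialSeries_mem (τ : StackPartition) : monomialSeries τ ∈ PLambda := by
  rw [mem_PLambda_iff]
  refine ⟨⟨τ.size, fun n hn => ?_⟩, fun m σ => ?_⟩
  · by_cases h : ∃ α, Admissible τ α ∧ n = stackMonomial τ α
    · obtain ⟨α, -, rfl⟩ := h
      exact (wdeg_stackMonomial τ α).le
    · exact absurd (coeff_monomialSeries_of_not_exists τ n h) hn
  · rw [renameEquiv_eq_self_iff]
    intro n
    by_cases h : ∃ α, Admissible τ α ∧ n = stackMonomial τ α
    · rw [coeff_monomialSeries_of_exists τ n h,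
        coeff_monomialSeries_of_exists τ _ (exists_admissible_perm τ m σ n h)]
    · rw [coeff_monomialSeries_of_not_exists τ n h,
        coeff_monomialSeries_of_not_exists τ _ fun h' => h ?_]
      have h2 := exists_admissible_perm τ m σ.symm _ h'
      have h3 : Finsupp.embDomain (rowPerm m σ.symm).toEmbedding
          (Finsupp.embDomain (rowPerm m σ).toEmbedding n) = n := by
        have hcomp : ∀ v : Var, rowPerm m σ.symm (rowPerm m σ v) = v := by
          rintro ⟨a, b⟩
          by_cases ha : a = m
          · subst ha
            simp [Equiv.Perm.prodExtendRight_apply_eq]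
          · simp [Equiv.Perm.prodExtendRight_apply_ne _ ha]
        ext v
        have e1 := Finsupp.embDomain_apply_self (rowPerm m σ.symm).toEmbedding
          (Finsupp.embDomain (rowPerm m σ).toEmbedding n) (rowPerm m σ v)
        have e2 := Finsupp.embDomain_apply_self (rowPerm m σ).toEmbedding n v
        simp only [Equiv.coe_toEmbedding, hcomp] at e1 e2
        rw [e1, e2]
      rwa [h3] at h2

/-- The monomial polysymmetric function `M_τ`, as an element of `PΛ`. -/
def M (τ : StackPartition) : PLambda := ⟨monomialSeries τ, monomialSeries_mem τ⟩

/-! ### The substitution `f(x) ↦ f(x^m)` -/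

theorem expand_mem (m : ℕ+) (f : MvPowerSeries Var ℚ) (hf : f ∈ PLambda) :
    MvPowerSeries.expand (m : ℕ) m.ne_zero f ∈ PLambda := by
  have hdiv : ∀ n : Var →₀ ℕ, (∃ k, n = (m : ℕ) • k) ∨
      MvPowerSeries.coeff n (MvPowerSeries.expand (m : ℕ) m.ne_zero f) = 0 := by
    intro n
    by_cases h : ∀ v, (m : ℕ) ∣ n v
    · left
      refine ⟨n.mapRange (· / (m : ℕ)) (Nat.zero_div _), ?_⟩
      ext v
      simp [Nat.mul_div_cancel' (h v)]
    · right
      obtain ⟨v, hv⟩ := not_forall.1 h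
      exact MvPowerSeries.coeff_expand_of_not_dvd _ _ f hv
  rw [mem_PLambda_iff] at hf ⊢
  obtain ⟨⟨N, hN⟩, hf⟩ := hf
  refine ⟨⟨(m : ℕ) * N, fun n hn => ?_⟩, fun k σ => ?_⟩
  · obtain ⟨k, rfl⟩ := (hdiv n).resolve_right hn
    rw [MvPowerSeries.coeff_expand_smul] at hn
    rw [map_nsmul, smul_eq_mul]
    exact Nat.mul_le_mul_left _ (hN k hn)
  · have hk := (renameEquiv_eq_self_iff _ _).1 (hf k σ)
    rw [renameEquiv_eq_self_iff]
    intro n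
    have hsmul : ∀ a : Var →₀ ℕ, Finsupp.embDomain (rowPerm k σ).toEmbedding ((m : ℕ) • a) =
        (m : ℕ) • Finsupp.embDomain (rowPerm k σ).toEmbedding a := by
      intro a
      rw [Finsupp.embDomain_eq_mapDomain, Finsupp.embDomain_eq_mapDomain, Finsupp.mapDomain_smul]
    by_cases h : ∃ a, n = (m : ℕ) • a
    · obtain ⟨a, rfl⟩ := h
      rw [hsmul, MvPowerSeries.coeff_expand_smul, MvPowerSeries.coeff_expand_smul, hk]
    · rw [(hdiv n).resolve_left h]
      refine (hdiv _).resolve_left fun ⟨b, hb⟩ => h ?_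
      refine ⟨n.mapRange (· / (m : ℕ)) (Nat.zero_div _), ?_⟩
      ext v
      have e := Finsupp.embDomain_apply_self (rowPerm k σ).toEmbedding n v
      rw [hb] at e
      have : (m : ℕ) ∣ n v := ⟨_, e.symm⟩
      simp [Nat.mul_div_cancel' this]

/-- The algebra map `f(x) ↦ f(x^m)` on `PΛ` that replaces every variable `x_{i,j}` by
`x_{i,j}^m`. -/
def powVars (m : ℕ+) : PLambda →ₐ[ℚ] PLambda :=
  ((MvPowerSeries.expand (m : ℕ) m.ne_zero).comp PLambda.val).codRestrict PLambda
    fun f => expand_mem m f.1 f.2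

/-! ### The families `E⁺` and `H⁺` -/

open Classical in
/-- The unsigned elementary polysymmetric function `E⁺_d = ∑ M_α`, over the ordinary
partitions `α` of `d`. -/
def Eplus (d : ℕ) : PLambda :=
  ∑ α ∈ (StackPartition.ofSize d).filter StackPartition.IsOrdinary, M α

/-- The signed complete homogeneous polysymmetric function `H⁺_d = ∑ sgn(α) M_α`, over all
stack partitions `α` of `d`. -/
def Hplus (d : ℕ) : PLambda := ∑ α ∈ StackPartition.ofSize d, α.sgn • M α

/-- `E⁺_{d^m}(x) = E⁺_d(x^m)`. -/
def EplusStack (d m : ℕ+) : PLambda := powVars m (Eplus d)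

/-- `H⁺_{d^m}(x) = H⁺_d(x^m)`. -/
def HplusStack (d m : ℕ+) : PLambda := powVars m (Hplus d)

/-- `H⁺_τ = H⁺_{d_1^{m_1}} ⋯ H⁺_{d_s^{m_s}}` for `τ = (d_1^{m_1}, …, d_s^{m_s})`. -/
def HplusPartition (τ : StackPartition) : PLambda :=
  (τ.parts.map fun s => HplusStack s.deg s.mult).prod

end Polysymmetric

end

noncomputable section

namespace Polysymmetric

/-! ### Stack partitions as multisets of stacks -/

namespace StackPartition

/-! Collecting the `E⁺_d` and `H⁺_d` (with value `1` at `d = 0`) into generating functions gives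
`E⁺(t) = ∏ (1 + x_{m,j} t^m)` and `H⁺(t) = ∏ (1 + x_{m,j} t^m)⁻¹`, so `E⁺(t) H⁺(t) = 1`
(`mk_Eplus_mul_mk_Hplus`). The substitution `x ↦ x^m` is a ring map, so the same identity holds for
the series of the `E⁺_{d^m}` and `H⁺_{d^m}` with `m` fixed.

The algebra `PΛ` is the polynomial ring in the `E⁺_{d^m}`. They generate (`adjoin_EplusStack`):
`E⁺_{d^m}` is the power sum `∑_j x_{d,j}^m` plus terms in variables of degree less than `d`, and the
power sums generate every `M_τ`. They are independent by counting
(`linearIndependent_partsProd_EplusStack_of_size`): in degree `n` their products and the linearly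
independent `M_τ` are both indexed by the stack partitions of `n`, and the products span the `M_τ`.

Hence `Ω` exists and is unique. It carries `E⁺(t)` to `H⁺(t)`, so it carries the inverse `H⁺(t)` of
`E⁺(t)` to the inverse of `H⁺(t)`, which is `E⁺(t)` (`omega_HplusStack`). Thus `Ω` is an involution
on generators, hence everywhere; being bijective, it transports the bases built from `E⁺` to those
built from `H⁺`. -/

/-- The stack partition whose parts are the elements of a given multiset. -/
def ofMultiset (μ : Multiset Stack) : StackPartition :=
  ⟨μ.sort (· ≥ ·), (μ.pairwise_sort (· ≥ ·)).sortedGE⟩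

@[simp]
theorem coe_parts_ofMultiset (μ : Multiset Stack) : ((ofMultiset μ).parts : Multiset Stack) = μ :=
  μ.sort_eq (· ≥ ·)

/-- A stack partition is determined by its multiset of parts. -/
theorem coe_parts_injective {σ τ : StackPartition}
    (h : (σ.parts : Multiset Stack) = τ.parts) : σ = τ :=
  StackPartition.ext ((Multiset.coe_eq_coe.1 h).eq_of_sortedGE σ.sorted τ.sorted)

@[simp]
theorem ofMultiset_coe_parts (τ : StackPartition) : ofMultiset τ.parts = τ :=
  coe_parts_injective (coe_parts_ofMultiset _)

/-- Stack partitions are multisets of stacks. -/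
def equivMultiset : StackPartition ≃ Multiset Stack where
  toFun τ := τ.parts
  invFun := ofMultiset
  left_inv := ofMultiset_coe_parts
  right_inv := coe_parts_ofMultiset

theorem mem_ofSize {n : ℕ} {τ : StackPartition} : τ ∈ ofSize n ↔ τ.size = n := by
  simp [ofSize]

end StackPartition

open StackPartition

/-! ### The shape of a monomial -/

/-- The stack `d^m` attached to the power `x_{d,j}^m` of a variable. -/
def powStack (v : Var) (m : ℕ) : Stack := toLex (v.1, m.toPNat')

/-- The multiset of stacks `d^m` for which some `x_{d,j}^m` exactly divides a monomial. -/
def shape (n : Var →₀ ℕ) : Multiset Stack := n.support.val.map fun v => powStack v (n v)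

@[simp]
theorem shape_zero : shape 0 = 0 := by simp [shape]

theorem powStack_eq_iff {v : Var} {m : ℕ} (hm : m ≠ 0) {s : Stack} :
    powStack v m = s ↔ v.1 = s.deg ∧ m = s.mult := by
  have h : ∀ k : ℕ+, m.toPNat' = k ↔ m = k := fun k => by
    rw [← PNat.coe_inj, Nat.toPNat'_coe, if_pos (Nat.pos_of_ne_zero hm)]
  rw [← h]
  exact ⟨fun e => e ▸ ⟨rfl, rfl⟩, fun e => Prod.ext e.1 e.2⟩

theorem powStack_mult (v : Var) {m : ℕ} (hm : m ≠ 0) : ((powStack v m).mult : ℕ) = m :=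
  ((powStack_eq_iff hm).1 rfl).2.symm

theorem shape_single_add {v : Var} {m : ℕ} (hm : m ≠ 0) {n : Var →₀ ℕ} (hv : n v = 0) :
    shape (Finsupp.single v m + n) = powStack v m ::ₘ shape n := by
  classical
  have hd : Disjoint (Finsupp.single v m).support n.support := by
    rw [Finsupp.support_single _ hm]
    simpa using hv
  have hs : (Finsupp.single v m + n).support = Finset.cons v n.support (by simpa using hv) := by
    rw [Finsupp.support_add_eq hd, Finsupp.support_single _ hm, Finset.cons_eq_insert]
    rfl
  rw [shape, hs, Finset.cons_val, Multiset.map_cons, shape]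
  congr 1
  · simp [hv]
  · refine Multiset.map_congr rfl fun w hw => ?_
    have : v ≠ w := by
      rintro rfl
      exact Finsupp.mem_support_iff.1 hw hv
    simp [this]

theorem shape_sum_single {ι : Type*} (S : Finset ι) (v : ι → Var) (m : ι → ℕ)
    (hv : Set.InjOn v S) (hm : ∀ i ∈ S, m i ≠ 0) :
    shape (∑ i ∈ S, Finsupp.single (v i) (m i)) = S.val.map fun i => powStack (v i) (m i) := by
  classical
  induction S using Finset.cons_induction with
  | empty => simp
  | cons a S ha ih =>
    rw [Finset.sum_cons, shape_single_add (hm a (by simp)), ih (hv.mono (by simp))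
      (fun i hi => hm i (by simp [hi])), Finset.cons_val, Multiset.map_cons]
    rw [Finsupp.finsetSum_apply]
    refine Finset.sum_eq_zero fun i hi => ?_
    rw [Finsupp.single_apply, if_neg]
    intro h
    have := hv (Finset.mem_coe.2 (Finset.mem_cons_of_mem hi)) (by simp) h
    exact ha (this ▸ hi)

theorem shape_stackMonomial {τ : StackPartition} {α : Fin τ.parts.length → ℕ+}
    (h : Admissible τ α) : shape (stackMonomial τ α) = τ.parts := by
  rw [stackMonomial, shape_sum_single]
  · have : ∀ i, powStack ((τ.parts.get i).deg, α i) ((τ.parts.get i).mult : ℕ) = τ.parts.get i :=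
      fun i => (powStack_eq_iff (PNat.ne_zero _)).2 ⟨rfl, rfl⟩
    simp only [this]
    rw [Fin.univ_val_map, List.ofFn_get]
  · intro i _ j _ hij
    by_contra hne
    exact h i j hne (Prod.mk.inj hij).1 (Prod.mk.inj hij).2
  · intro i _
    exact PNat.ne_zero _

/-- A monomial of a given shape. -/
def shapeRep (μ : Multiset Stack) : Var →₀ ℕ :=
  stackMonomial (ofMultiset μ) fun i => Nat.succPNat i

theorem admissible_succPNat (τ : StackPartition) : Admissible τ fun i => Nat.succPNat i :=
  fun _ _ hij _ h => hij (Fin.ext (Nat.succPNat_injective h))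

@[simp]
theorem shape_shapeRep (μ : Multiset Stack) : shape (shapeRep μ) = μ := by
  rw [shapeRep, shape_stackMonomial (admissible_succPNat _), coe_parts_ofMultiset]

/-- The shape records how often each nonzero exponent occurs in each row; this is what allows two
monomials of equal shape to be matched row by row. -/
theorem count_shape (n : Var →₀ ℕ) (s : Stack) :
    (shape n).count s = Nat.card {j : ℕ+ // n (s.deg, j) = s.mult} := by
  classical
  rw [shape, Multiset.count_map, ← Finset.filter_val, Finset.card_val, ← Fintype.card_coe,
    ← Nat.card_eq_fintype_card]
  have h : ∀ v : Var, v ∈ n.support.filter (fun v => s = powStack v (n v)) ↔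
      v.1 = s.deg ∧ n v = s.mult := by
    intro v
    rw [Finset.mem_filter, Finsupp.mem_support_iff]
    constructor
    · rintro ⟨h0, h1⟩
      exact (powStack_eq_iff h0).1 h1.symm
    · rintro ⟨h1, h2⟩
      have h0 : n v ≠ 0 := h2 ▸ s.mult.ne_zero
      exact ⟨h0, ((powStack_eq_iff h0).2 ⟨h1, h2⟩).symm⟩
  refine Nat.card_congr
    { toFun := fun v => ⟨v.1.2, ?_⟩
      invFun := fun j => ⟨(s.deg, j.1), (h _).2 ⟨rfl, j.2⟩⟩
      left_inv := fun v => Subtype.ext (Prod.ext ((h _).1 v.2).1.symm rfl)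
      right_inv := fun j => rfl }
  obtain ⟨h1, h2⟩ := (h _).1 v.2
  rw [← h1]
  exact h2

theorem wdeg_eq_sum_shape (n : Var →₀ ℕ) :
    wdeg n = ((shape n).map fun s => (s.deg : ℕ) * (s.mult : ℕ)).sum := by
  rw [shape, Multiset.map_map, wdeg, Finsupp.weight_apply, Finsupp.sum]
  refine Finset.sum_congr rfl fun v hv => ?_
  rw [Function.comp, powStack_mult v (Finsupp.mem_support_iff.1 hv), smul_eq_mul, mul_comm]
  rfl

theorem size_ofMultiset_shape (n : Var →₀ ℕ) : (ofMultiset (shape n)).size = wdeg n := by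
  rw [wdeg_eq_sum_shape, size, ← Multiset.sum_coe, ← Multiset.map_coe, coe_parts_ofMultiset]

/-! ### Coefficients of polysymmetric functions depend only on the shape -/

/-- The permutation is glued from bijections between the fibres of the two exponent functions on row
`d`. Over a nonzero exponent the fibres are finite of equal size; over `0` both are cofinite, hence
countably infinite. -/
theorem exists_rowPerm_of_shape_eq {n n' : Var →₀ ℕ} (h : shape n = shape n') (d : ℕ+) :
    ∃ σ : Equiv.Perm ℕ+, ∀ j, n' (d, σ j) = n (d, j) := by
  have hfin : ∀ (k : Var →₀ ℕ) (c : ℕ), c ≠ 0 → Finite {j : ℕ+ // k (d, j) = c} := by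
    intro k c hc
    refine Finite.of_injective
      (fun j => (⟨(d, j.1), by simp [j.2, hc]⟩ : k.support)) fun i j hij => ?_
    exact Subtype.ext (congrArg Prod.snd (congrArg Subtype.val hij))
  have hinf : ∀ k : Var →₀ ℕ, Infinite {j : ℕ+ // k (d, j) = 0} := by
    intro k
    have : {j : ℕ+ | k (d, j) = 0}ᶜ.Finite := by
      refine (k.support.finite_toSet.image Prod.snd).subset fun j hj => ⟨(d, j), ?_, rfl⟩
      simpa using hj
    exact (Set.infinite_of_finite_compl this).to_subtype
  have key : ∀ c, Nonempty ({j : ℕ+ // n (d, j) = c} ≃ {j : ℕ+ // n' (d, j) = c}) := by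
    intro c
    rcases Nat.eq_zero_or_pos c with rfl | hc
    · have := hinf n
      have := hinf n'
      obtain ⟨i⟩ := nonempty_denumerable {j : ℕ+ // n (d, j) = 0}
      obtain ⟨i'⟩ := nonempty_denumerable {j : ℕ+ // n' (d, j) = 0}
      exact ⟨Denumerable.equiv₂ _ _⟩
    · have := hfin n c hc.ne'
      have := hfin n' c hc.ne'
      have h1 : Nat.card {j : ℕ+ // n (d, j) = c} = Nat.card {j : ℕ+ // n' (d, j) = c} :=
        (count_shape n (toLex (d, ⟨c, hc⟩))).symm.trans (h ▸ count_shape n' (toLex (d, ⟨c, hc⟩)))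
      exact ⟨(Finite.equivFin _).trans ((finCongr h1).trans (Finite.equivFin _).symm)⟩
  refine ⟨Equiv.ofFiberEquiv fun c => (key c).some, fun j => ?_⟩
  exact Equiv.ofFiberEquiv_map (f := fun j => n (d, j)) (g := fun j => n' (d, j)) _ j

/-- Invariance is only given for permutations of a single row, so the rows in `D` are corrected one
at a time. -/
theorem coeff_eq_of_rowPerm {f : MvPowerSeries Var ℚ} (hf : f ∈ PLambda) (D : Finset ℕ+) :
    ∀ n n' : Var →₀ ℕ, (∀ v : Var, v.1 ∉ D → n v = n' v) →
      (∀ d ∈ D, ∃ σ : Equiv.Perm ℕ+, ∀ j, n' (d, σ j) = n (d, j)) →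
      MvPowerSeries.coeff n f = MvPowerSeries.coeff n' f := by
  classical
  induction D using Finset.induction_on with
  | empty =>
    intro n n' h _
    rw [Finsupp.ext fun v => h v (by simp)]
  | insert d D hd ih =>
    intro n n' h1 h2
    obtain ⟨σ, hσ⟩ := h2 d (by simp)
    have hinv := (renameEquiv_eq_self_iff _ _).1 (((mem_PLambda_iff f).1 hf).2 d σ) n
    have hrow : ∀ j, Finsupp.embDomain (rowPerm d σ).toEmbedding n (d, σ j) = n (d, j) := by
      intro j
      have := Finsupp.embDomain_apply_self (rowPerm d σ).toEmbedding n (d, j)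
      rwa [Equiv.coe_toEmbedding, Equiv.Perm.prodExtendRight_apply_eq] at this
    have hother : ∀ a j, a ≠ d →
        Finsupp.embDomain (rowPerm d σ).toEmbedding n (a, j) = n (a, j) := by
      intro a j ha
      have := Finsupp.embDomain_apply_self (rowPerm d σ).toEmbedding n (a, j)
      rwa [Equiv.coe_toEmbedding, Equiv.Perm.prodExtendRight_apply_ne _ ha] at this
    rw [← hinv]
    refine ih _ _ ?_ ?_
    · rintro ⟨a, j⟩ ha
      by_cases had : a = d
      · subst had
        obtain ⟨i, rfl⟩ := σ.surjective j
        rw [hrow, hσ]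
      · rw [hother a j had]
        exact h1 _ (by simp_all)
    · intro a ha
      have had : a ≠ d := fun e => hd (e ▸ ha)
      obtain ⟨ρ, hρ⟩ := h2 a (Finset.mem_insert_of_mem ha)
      exact ⟨ρ, fun j => by rw [hρ, hother a j had]⟩

theorem coeff_eq_of_shape_eq {f : MvPowerSeries Var ℚ} (hf : f ∈ PLambda) {n n' : Var →₀ ℕ}
    (h : shape n = shape n') : MvPowerSeries.coeff n f = MvPowerSeries.coeff n' f := by
  classical
  refine coeff_eq_of_rowPerm hf ((n.support ∪ n'.support).image Prod.fst) n n' ?_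
    fun d _ => exists_rowPerm_of_shape_eq h d
  intro v hv
  have hv' : v ∉ n.support ∪ n'.support := fun hmem => hv (Finset.mem_image_of_mem _ hmem)
  simp only [Finset.mem_union, Finsupp.mem_support_iff, not_or, not_not] at hv'
  rw [hv'.1, hv'.2]

/-- By invariance it suffices to exhibit one monomial of each shape with coefficient `1`, namely the
one with indices `α_i = i + 1`. -/
theorem coeff_M (n : Var →₀ ℕ) (τ : StackPartition) [Decidable (shape n = τ.parts)] :
    MvPowerSeries.coeff n (M τ : MvPowerSeries Var ℚ) = if shape n = τ.parts then 1 else 0 := by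
  split_ifs with h
  · rw [coeff_eq_of_shape_eq (M τ).2
      (h.trans (shape_stackMonomial (admissible_succPNat τ)).symm)]
    exact coeff_monomialSeries_of_exists _ _ ⟨_, admissible_succPNat τ, rfl⟩
  · refine coeff_monomialSeries_of_not_exists _ _ ?_
    rintro ⟨α, hα, rfl⟩
    exact h (shape_stackMonomial hα)

/-- An element of `PΛ` lies in every submodule that contains the `M_τ` for the shapes `τ` of its
monomials. -/
theorem mem_of_forall_shape_mem (B : Submodule ℚ PLambda) (f : PLambda)
    (h : ∀ n : Var →₀ ℕ, MvPowerSeries.coeff n (f : MvPowerSeries Var ℚ) ≠ 0 →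
      M (ofMultiset (shape n)) ∈ B) : f ∈ B := by
  classical
  obtain ⟨⟨N, hN⟩, -⟩ := (mem_PLambda_iff f.1).1 f.2
  -- Bounded degree makes the expansion of `f` in the `M_τ` finite: only stack partitions of size at
  -- most `N` occur, and the coefficient of `M_τ` is read off at a representative monomial.
  set T := (Finset.range (N + 1)).biUnion ofSize with hT
  have hf : f = ∑ τ ∈ T, MvPowerSeries.coeff (shapeRep τ.parts) f.1 • M τ := by
    refine Subtype.ext (MvPowerSeries.ext fun n => ?_)
    rw [AddSubmonoidClass.coe_finsetSum, map_sum]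
    have hterm : ∀ τ ∈ T, MvPowerSeries.coeff n
        ((MvPowerSeries.coeff (shapeRep τ.parts) f.1 • M τ : PLambda) : MvPowerSeries Var ℚ) =
        if τ = ofMultiset (shape n) then MvPowerSeries.coeff n f.1 else 0 := by
      intro τ _
      rw [Subalgebra.coe_smul, map_smul, coeff_M]
      by_cases hτ : shape n = τ.parts
      · rw [if_pos hτ, if_pos (by rw [hτ, ofMultiset_coe_parts]), ← hτ,
          coeff_eq_of_shape_eq f.2 (shape_shapeRep (shape n))]
        simp
      · rw [if_neg hτ, if_neg (fun e => hτ (by rw [e, coe_parts_ofMultiset]))]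
        simp
    rw [Finset.sum_congr rfl hterm, Finset.sum_ite_eq']
    split_ifs with hmem
    · rfl
    · by_contra hne
      refine hmem (Finset.mem_biUnion.2 ⟨wdeg n, ?_, mem_ofSize.2 (size_ofMultiset_shape n)⟩)
      exact Finset.mem_range.2 (Nat.lt_succ_of_le (hN n hne))
  rw [hf]
  refine Submodule.sum_mem _ fun τ _ => ?_
  by_cases hc : MvPowerSeries.coeff (shapeRep τ.parts) f.1 = 0
  · rw [hc, zero_smul]
    exact zero_mem _
  · have := h _ hc
    rw [shape_shapeRep, ofMultiset_coe_parts] at this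
    exact B.smul_mem _ this

theorem linearIndependent_M : LinearIndependent ℚ M := by
  classical
  rw [linearIndependent_iff']
  intro s g hg τ hτ
  have h := congrArg (fun f : PLambda => MvPowerSeries.coeff (shapeRep τ.parts) f.1) hg
  simp only [AddSubmonoidClass.coe_finsetSum, map_sum, Subalgebra.coe_smul, map_smul, coeff_M,
    shape_shapeRep, ZeroMemClass.coe_zero, map_zero] at h
  rw [Finset.sum_eq_single τ] at h
  · simpa using h
  · intro σ _ hne
    rw [if_neg fun e => hne (coe_parts_injective e.symm), smul_zero]
  · exact fun h' => absurd hτ h'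

/-! ### Coefficients of `E⁺` and `H⁺` -/

theorem coeff_sum_smul_M (T : Finset StackPartition) (c : StackPartition → ℚ) (n : Var →₀ ℕ)
    [Decidable (ofMultiset (shape n) ∈ T)] :
    MvPowerSeries.coeff n ((∑ τ ∈ T, c τ • M τ : PLambda) : MvPowerSeries Var ℚ) =
      if ofMultiset (shape n) ∈ T then c (ofMultiset (shape n)) else 0 := by
  classical
  rw [AddSubmonoidClass.coe_finsetSum, map_sum]
  have hterm : ∀ τ ∈ T, MvPowerSeries.coeff n ((c τ • M τ : PLambda) : MvPowerSeries Var ℚ) =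
      if ofMultiset (shape n) = τ then c τ else 0 := by
    intro τ _
    rw [Subalgebra.coe_smul, map_smul, coeff_M]
    by_cases hτ : shape n = τ.parts
    · rw [if_pos hτ, if_pos (by rw [hτ, ofMultiset_coe_parts])]
      simp
    · rw [if_neg hτ, if_neg (fun e => hτ (by rw [← e, coe_parts_ofMultiset]))]
      simp
  rw [Finset.sum_congr rfl hterm, Finset.sum_ite_eq]
  split_ifs <;> rfl

theorem isOrdinary_ofMultiset_shape (n : Var →₀ ℕ) :
    (ofMultiset (shape n)).IsOrdinary ↔ ∀ v, n v ≤ 1 := by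
  have h1 : (ofMultiset (shape n)).IsOrdinary ↔ ∀ s ∈ shape n, s.mult = 1 := by
    conv_rhs => rw [← coe_parts_ofMultiset (shape n)]
    rfl
  rw [h1, shape]
  simp only [Multiset.mem_map, Finset.mem_val, Finsupp.mem_support_iff, forall_exists_index,
    and_imp, forall_apply_eq_imp_iff₂]
  refine forall_congr' fun v => ?_
  by_cases hv : n v = 0
  · simp [hv]
  · rw [← PNat.coe_inj, powStack_mult v hv, PNat.one_coe]
    simp only [ne_eq, hv, not_false_eq_true, forall_true_left]
    omega

-- This is the coefficient in `∏ (1 + x_{m,j} t^m)`: only squarefree monomials occur.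
open Classical in
theorem coeff_Eplus (d : ℕ) (n : Var →₀ ℕ) :
    MvPowerSeries.coeff n (Eplus d : MvPowerSeries Var ℚ) =
      if wdeg n = d ∧ ∀ v, n v ≤ 1 then 1 else 0 := by
  have h := coeff_sum_smul_M ((ofSize d).filter IsOrdinary) (fun _ => 1) n
  simp only [one_smul] at h
  rw [Eplus, h]
  simp only [Finset.mem_filter, mem_ofSize, size_ofMultiset_shape, isOrdinary_ofMultiset_shape]

theorem area_ofMultiset_shape (n : Var →₀ ℕ) : (ofMultiset (shape n)).area = n.degree := by
  rw [area, ← Multiset.sum_coe, ← Multiset.map_coe, coe_parts_ofMultiset, shape, Multiset.map_map,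
    Finsupp.degree_apply]
  exact Finset.sum_congr rfl fun v hv => powStack_mult v (Finsupp.mem_support_iff.1 hv)

/-- This is the coefficient in `∏ (1 + x_{m,j} t^m)⁻¹`, since the area of the shape is the
unweighted degree of the monomial. -/
theorem coeff_Hplus (d : ℕ) (n : Var →₀ ℕ) :
    MvPowerSeries.coeff n (Hplus d : MvPowerSeries Var ℚ) =
      if wdeg n = d then (-1) ^ n.degree else 0 := by
  classical
  rw [Hplus, coeff_sum_smul_M]
  simp only [mem_ofSize, size_ofMultiset_shape, sgn, area_ofMultiset_shape]

theorem wdeg_eq_zero_iff {n : Var →₀ ℕ} : wdeg n = 0 ↔ n = 0 := by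
  refine ⟨fun h => ?_, fun h => by rw [h, map_zero]⟩
  rw [wdeg, Finsupp.weight_apply, Finsupp.sum, Finset.sum_eq_zero_iff] at h
  ext v
  by_contra hv
  have := h v (Finsupp.mem_support_iff.2 hv)
  simp_all

/-! ### The generating functions of `E⁺` and `H⁺` are inverse to each other -/

-- A squarefree divisor of a monomial is a subset of its support, so this is the alternating sum
-- over all subsets of the support, which vanishes unless the support is empty.
open Classical in
theorem sum_antidiagonal_squarefree (n : Var →₀ ℕ) :
    ∑ p ∈ Finset.HasAntidiagonal.antidiagonal n with ∀ v, p.1 v ≤ 1, (-1 : ℚ) ^ p.2.degree =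
      if n = 0 then 1 else 0 := by
  classical
  have hdeg : ∀ a : Var →₀ ℕ, (∀ v, a v ≤ 1) → a.degree = a.support.card := by
    intro a ha
    rw [Finsupp.degree_apply, Finset.card_eq_sum_ones]
    refine Finset.sum_congr rfl fun v hv => ?_
    have := Finsupp.mem_support_iff.1 hv
    have := ha v
    omega
  have hbij : ∑ p ∈ Finset.HasAntidiagonal.antidiagonal n with ∀ v, p.1 v ≤ 1, (-1 : ℚ) ^ p.2.degree =
      ∑ S ∈ n.support.powerset, (-1 : ℚ) ^ n.degree * (-1) ^ S.card := by
    refine Finset.sum_nbij' (fun p => p.1.support)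
      (fun S => (Finsupp.indicator S fun _ _ => 1, n - Finsupp.indicator S fun _ _ => 1))
      ?_ ?_ ?_ ?_ ?_
    · rintro ⟨a, b⟩ hp
      simp only [Finset.mem_filter, Finset.HasAntidiagonal.mem_antidiagonal] at hp
      rw [Finset.mem_powerset, ← hp.1]
      intro v hv
      simp only [Finsupp.mem_support_iff, Finsupp.add_apply] at hv ⊢
      omega
    · intro S hS
      rw [Finset.mem_powerset] at hS
      simp only [Finset.mem_filter, Finset.HasAntidiagonal.mem_antidiagonal]
      refine ⟨add_tsub_cancel_of_le fun v => ?_, fun v => ?_⟩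
      · by_cases hv : v ∈ S
        · have := Finsupp.mem_support_iff.1 (hS hv)
          simp only [Finsupp.indicator_apply, hv, dif_pos]
          omega
        · simp [Finsupp.indicator_apply, hv]
      · by_cases hv : v ∈ S <;> simp [Finsupp.indicator_apply, hv]
    · rintro ⟨a, b⟩ hp
      simp only [Finset.mem_filter, Finset.HasAntidiagonal.mem_antidiagonal] at hp
      have ha : (Finsupp.indicator a.support fun _ _ => 1) = a := by
        ext v
        have := hp.2 v
        by_cases hv : a v = 0
        · simp [Finsupp.indicator_apply, hv]
        · simp only [Finsupp.indicator_apply, Finsupp.mem_support_iff, ne_eq, hv, not_false_eq_true,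
            dif_pos]
          omega
      simp only [ha, ← hp.1, add_tsub_cancel_left]
    · intro S hS
      ext v
      simp [Finsupp.indicator_apply]
    · rintro ⟨a, b⟩ hp
      simp only [Finset.mem_filter, Finset.HasAntidiagonal.mem_antidiagonal] at hp
      -- As `a` is squarefree, `|S| = deg a`; the two factors `(-1)^(deg a)` cancel, leaving
      -- `(-1)^(deg b)`.
      rw [← hp.1, map_add, pow_add, ← hdeg a hp.2, mul_right_comm, ← pow_add, ← two_mul, pow_mul]
      simp
  rw [hbij, ← Finset.mul_sum]
  have h := congrArg (Int.cast : ℤ → ℚ) (Finset.sum_powerset_neg_one_pow_card (x := n.support))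
  push_cast at h
  rw [h]
  simp only [Finsupp.support_eq_empty]
  split_ifs with h0
  · simp [h0]
  · simp

theorem mk_Eplus_mul_mk_Hplus :
    (PowerSeries.mk Eplus * PowerSeries.mk Hplus : PowerSeries PLambda) = 1 := by
  classical
  ext N : 1
  rw [PowerSeries.coeff_mul, PowerSeries.coeff_one]
  simp only [PowerSeries.coeff_mk]
  refine Subtype.ext (MvPowerSeries.ext (R := ℚ) fun n : Var →₀ ℕ => ?_)
  -- The factorisations of `n` are sorted by the weights of their two factors. After exchanging the
  -- sums, each factorisation is counted exactly once if `n` has weight `N`, and never otherwise.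
  have hterm : ∀ q ∈ Finset.HasAntidiagonal.antidiagonal N,
      MvPowerSeries.coeff n ((Eplus q.1 * Hplus q.2 : PLambda) : MvPowerSeries Var ℚ) =
      ∑ p ∈ Finset.HasAntidiagonal.antidiagonal n with ∀ v, p.1 v ≤ 1,
        if (wdeg p.1, wdeg p.2) = q then (-1 : ℚ) ^ p.2.degree else 0 := by
    rintro ⟨i, j⟩ _
    rw [MulMemClass.coe_mul, MvPowerSeries.coeff_mul, Finset.sum_filter]
    refine Finset.sum_congr rfl fun p _ => ?_
    rw [coeff_Eplus, coeff_Hplus]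
    simp only [Prod.mk.injEq]
    split_ifs <;> simp_all
  rw [AddSubmonoidClass.coe_finsetSum, map_sum, Finset.sum_congr rfl hterm, Finset.sum_comm]
  have hinner : ∀ p ∈ (Finset.HasAntidiagonal.antidiagonal n).filter (fun p => ∀ v, p.1 v ≤ 1),
      (∑ q ∈ Finset.HasAntidiagonal.antidiagonal N,
        if (wdeg p.1, wdeg p.2) = q then (-1 : ℚ) ^ p.2.degree else 0) =
      if wdeg n = N then (-1 : ℚ) ^ p.2.degree else 0 := by
    intro p hp
    have hn := Finset.HasAntidiagonal.mem_antidiagonal.1 (Finset.mem_filter.1 hp).1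
    rw [Finset.sum_ite_eq]
    simp only [Finset.HasAntidiagonal.mem_antidiagonal, ← map_add, hn]
  rw [Finset.sum_congr rfl hinner]
  by_cases hN : wdeg n = N
  · simp only [hN, if_true]
    rw [sum_antidiagonal_squarefree]
    have : n = 0 ↔ N = 0 := by rw [← hN, wdeg_eq_zero_iff]
    by_cases h0 : N = 0
    · simp [h0, this.2 h0]
    · simp [h0, mt this.1 h0]
  · simp only [hN, if_false, Finset.sum_const_zero]
    split_ifs with h0
    · have : n ≠ 0 := by
        rintro rfl
        exact hN (by simp [h0])
      simp [MvPowerSeries.coeff_one, this]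
    · simp

/-! ### The `E⁺_{d^m}` generate `PΛ` -/

theorem M_ofMultiset_zero : M (ofMultiset 0) = 1 := by
  classical
  refine Subtype.ext (MvPowerSeries.ext fun n => ?_)
  rw [coeff_M, coe_parts_ofMultiset, OneMemClass.coe_one, MvPowerSeries.coeff_one]
  refine if_congr ?_ rfl rfl
  simp [shape]

/-- Consequently `M (ofMultiset {d^m})` is the power sum `∑_j x_{d,j}^m`. -/
theorem shape_eq_singleton_iff {n : Var →₀ ℕ} {s : Stack} :
    shape n = {s} ↔ ∃ v : Var, v.1 = s.deg ∧ n = Finsupp.single v (s.mult : ℕ) := by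
  constructor
  · intro h
    obtain ⟨v, hv⟩ := Finset.card_eq_one.1 (show n.support.card = 1 by
      simpa [shape] using congrArg Multiset.card h)
    have hv0 : n v ≠ 0 := Finsupp.mem_support_iff.1 (by simp [hv])
    rw [shape, hv, Finset.singleton_val, Multiset.map_singleton, Multiset.singleton_inj,
      powStack_eq_iff hv0] at h
    refine ⟨v, h.1, ?_⟩
    rw [← h.2]
    exact (Finsupp.support_subset_singleton.1 hv.le)
  · rintro ⟨v, hv, rfl⟩
    have := shape_single_add (v := v) (PNat.ne_zero s.mult) (n := 0) rfl
    rw [add_zero] at this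
    rw [this, (powStack_eq_iff (PNat.ne_zero _)).2 ⟨hv, rfl⟩]
    simp

theorem exists_of_coeff_M_mul_M_ne_zero {s : Stack} {μ : Multiset Stack} {n : Var →₀ ℕ}
    (h : MvPowerSeries.coeff n
      ((M (ofMultiset {s}) * M (ofMultiset μ) : PLambda) : MvPowerSeries Var ℚ) ≠ 0) :
    ∃ (v : Var) (k : Var →₀ ℕ), v.1 = s.deg ∧ shape k = μ ∧
      n = Finsupp.single v (s.mult : ℕ) + k := by
  classical
  rw [MulMemClass.coe_mul, MvPowerSeries.coeff_mul] at h
  obtain ⟨⟨a, b⟩, hp, hne⟩ := Finset.exists_ne_zero_of_sum_ne_zero h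
  have ha := left_ne_zero_of_mul hne
  have hb := right_ne_zero_of_mul hne
  rw [coeff_M, coe_parts_ofMultiset, ne_eq, ite_eq_right_iff, not_forall] at ha hb
  obtain ⟨v, hv, hav⟩ := shape_eq_singleton_iff.1 ha.1
  refine ⟨v, b, hv, hb.1, ?_⟩
  rw [← hav]
  exact (Finset.HasAntidiagonal.mem_antidiagonal.1 hp).symm

/-- Multiply a monomial of shape `μ` by the power of a variable with an unused index. All
contributions to the coefficient are nonnegative, so nothing cancels. -/
theorem exists_shape_cons_coeff_ne_zero (s : Stack) (μ : Multiset Stack) :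
    ∃ n : Var →₀ ℕ, shape n = s ::ₘ μ ∧ MvPowerSeries.coeff n
      ((M (ofMultiset {s}) * M (ofMultiset μ) : PLambda) : MvPowerSeries Var ℚ) ≠ 0 := by
  classical
  obtain ⟨j, hj⟩ := Infinite.exists_notMem_finset ((shapeRep μ).support.image Prod.snd)
  have hv : shapeRep μ (s.deg, j) = 0 := by
    by_contra h
    exact hj (Finset.mem_image.2 ⟨_, Finsupp.mem_support_iff.2 h, rfl⟩)
  refine ⟨Finsupp.single (s.deg, j) (s.mult : ℕ) + shapeRep μ, ?_, ne_of_gt ?_⟩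
  · rw [shape_single_add (PNat.ne_zero _) hv, shape_shapeRep,
      (powStack_eq_iff (v := (s.deg, j)) (PNat.ne_zero _) (s := s)).2 ⟨rfl, rfl⟩]
  · rw [MulMemClass.coe_mul, MvPowerSeries.coeff_mul]
    refine Finset.sum_pos' (fun p _ => ?_)
      ⟨(Finsupp.single (s.deg, j) (s.mult : ℕ), shapeRep μ), by simp, ?_⟩
    · rw [coeff_M, coeff_M]
      split_ifs <;> simp
    · rw [coeff_M, coeff_M, coe_parts_ofMultiset, coe_parts_ofMultiset,
        if_pos (shape_eq_singleton_iff (s := s).2 ⟨(s.deg, j), rfl, rfl⟩), if_pos (shape_shapeRep μ)]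
      norm_num

theorem mem_shape_deg {n : Var →₀ ℕ} {D : Set ℕ+} :
    (∀ s ∈ shape n, s.deg ∈ D) ↔ ∀ v, n v ≠ 0 → v.1 ∈ D := by
  simp only [shape, Multiset.mem_map, Finset.mem_val, Finsupp.mem_support_iff, forall_exists_index,
    and_imp, forall_apply_eq_imp_iff₂]
  rfl

/-- A subalgebra that contains the power sums in the rows `d ∈ D` contains every `M_τ` in these
rows. -/
theorem M_mem_of_powerSum_mem (B : Subalgebra ℚ PLambda) (D : Set ℕ+)
    (hB : ∀ s : Stack, s.deg ∈ D → M (ofMultiset {s}) ∈ B) (k : ℕ) :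
    ∀ μ : Multiset Stack, μ.card ≤ k → (∀ s ∈ μ, s.deg ∈ D) → M (ofMultiset μ) ∈ B := by
  classical
  -- Induction on the number of parts: a power sum times `M_μ` is a nonzero multiple of `M_{s, μ}`
  -- plus terms with no more parts than `μ`.
  induction k with
  | zero =>
    intro μ hμ _
    rw [Multiset.card_eq_zero.1 (Nat.le_zero.1 hμ), M_ofMultiset_zero]
    exact one_mem B
  | succ k ih =>
    intro ν hν hD
    induction ν using Multiset.induction_on with
    | empty =>
      rw [M_ofMultiset_zero]
      exact one_mem B
    | cons s μ _ =>
      have hμ : μ.card ≤ k := by simpa using hν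
      have hDμ : ∀ t ∈ μ, t.deg ∈ D := fun t ht => hD t (Multiset.mem_cons_of_mem ht)
      have hDs : s.deg ∈ D := hD s (Multiset.mem_cons_self s μ)
      obtain ⟨n₀, hn₀, hc⟩ := exists_shape_cons_coeff_ne_zero s μ
      set g : PLambda := M (ofMultiset {s}) * M (ofMultiset μ) with hg
      set c := MvPowerSeries.coeff n₀ (g : MvPowerSeries Var ℚ) with hcdef
      have hgB : g ∈ B := B.mul_mem (hB s hDs) (ih μ hμ hDμ)
      have hsub : g - c • M (ofMultiset (s ::ₘ μ)) ∈ B := by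
        refine mem_of_forall_shape_mem (Subalgebra.toSubmodule B) _ fun n hn => ?_
        rw [AddSubgroupClass.coe_sub, map_sub, Subalgebra.coe_smul, map_smul, coeff_M,
          coe_parts_ofMultiset] at hn
        have hne : shape n ≠ s ::ₘ μ := by
          intro e
          rw [if_pos e, coeff_eq_of_shape_eq g.2 (e.trans hn₀.symm)] at hn
          simp [hcdef] at hn
        rw [if_neg hne, smul_zero, sub_zero] at hn
        obtain ⟨v, b, hv, rfl, rfl⟩ := exists_of_coeff_M_mul_M_ne_zero hn
        -- In any other monomial of the product, the new power falls on a variable already present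
        -- in `b`. The support does not grow, so the induction hypothesis applies.
        have hbv : b v ≠ 0 := by
          intro h0
          refine hne ?_
          rw [shape_single_add (PNat.ne_zero _) h0,
            (powStack_eq_iff (PNat.ne_zero _)).2 ⟨hv, rfl⟩]
        have hsupp : ∀ w, (Finsupp.single v (s.mult : ℕ) + b) w ≠ 0 → b w ≠ 0 := by
          intro w hw
          by_cases hvw : v = w
          · exact hvw ▸ hbv
          · simpa [hvw] using hw
        refine ih _ (le_trans ?_ hμ) (mem_shape_deg.2 fun w hw => mem_shape_deg.1 hDμ w (hsupp w hw))
        rw [shape, shape, Multiset.card_map, Multiset.card_map]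
        refine Finset.card_le_card fun w hw => ?_
        exact Finsupp.mem_support_iff.2 (hsupp w (Finsupp.mem_support_iff.1 hw))
      have hcM : c • M (ofMultiset (s ::ₘ μ)) ∈ B := by
        have := B.sub_mem hgB hsub
        rwa [sub_sub_cancel] at this
      have := B.smul_mem hcM c⁻¹
      rwa [smul_smul, inv_mul_cancel₀ hc, one_smul] at this

theorem coeff_powVars_smul (m : ℕ+) (f : PLambda) (n : Var →₀ ℕ) :
    MvPowerSeries.coeff ((m : ℕ) • n) (powVars m f : MvPowerSeries Var ℚ) =
      MvPowerSeries.coeff n (f : MvPowerSeries Var ℚ) :=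
  MvPowerSeries.coeff_expand_smul _ m.ne_zero _ _

theorem exists_smul_of_coeff_powVars_ne_zero {m : ℕ+} {f : PLambda} {n : Var →₀ ℕ}
    (h : MvPowerSeries.coeff n (powVars m f : MvPowerSeries Var ℚ) ≠ 0) :
    ∃ k : Var →₀ ℕ, n = (m : ℕ) • k := by
  refine ⟨n.mapRange (· / (m : ℕ)) (Nat.zero_div _), ?_⟩
  ext v
  have : (m : ℕ) ∣ n v := by
    by_contra hv
    exact h (MvPowerSeries.coeff_expand_of_not_dvd _ m.ne_zero f.1 hv)
  simp [Nat.mul_div_cancel' this]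

/-- The difference of `E⁺_{d^m}` and the power sum `M_{d^m}` only involves variables of degree
less than `d`. -/
theorem lt_of_coeff_EplusStack_sub_ne_zero {d m : ℕ+} {n : Var →₀ ℕ}
    (h : MvPowerSeries.coeff n
      ((EplusStack d m - M (ofMultiset {toLex (d, m)}) : PLambda) : MvPowerSeries Var ℚ) ≠ 0)
    (v : Var) (hv : n v ≠ 0) : v.1 < d := by
  classical
  rw [AddSubgroupClass.coe_sub, map_sub, coeff_M, coe_parts_ofMultiset] at h
  have hsingle : ∀ w : Var, w.1 = d →
      Finsupp.single w (m : ℕ) = (m : ℕ) • Finsupp.single w 1 := by simp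
  by_cases hs : shape n = {toLex (d, m)}
  · refine absurd ?_ h
    rw [if_pos hs]
    obtain ⟨w, hw, hnw⟩ := shape_eq_singleton_iff.1 hs
    have hnw' : n = (m : ℕ) • Finsupp.single w 1 := hnw.trans (hsingle w hw)
    rw [hnw', EplusStack, coeff_powVars_smul, coeff_Eplus, if_pos, sub_self]
    refine ⟨?_, fun u => ?_⟩
    · rw [wdeg, Finsupp.weight_single, one_smul, hw]
      rfl
    · rw [Finsupp.single_apply]
      split_ifs <;> simp
  · rw [if_neg hs, sub_zero] at h
    obtain ⟨k, rfl⟩ := exists_smul_of_coeff_powVars_ne_zero h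
    rw [EplusStack, coeff_powVars_smul, coeff_Eplus, ne_eq, ite_eq_right_iff, not_forall] at h
    obtain ⟨⟨hk, hk1⟩, -⟩ := h
    have hkv : k v ≠ 0 := fun h0 => hv (by simp [h0])
    -- A monomial of weight `d` containing a variable of degree at least `d` is that variable alone;
    -- its `m`-th power then has shape `d^m`, which is excluded here.
    have hdecomp : Finsupp.single v 1 + (k - Finsupp.single v 1) = k :=
      add_tsub_cancel_of_le (Finsupp.single_le_iff.2 (Nat.one_le_iff_ne_zero.2 hkv))
    have hw : (v.1 : ℕ) + wdeg (k - Finsupp.single v 1) = d := by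
      rw [← hk]
      conv_rhs => rw [← hdecomp, map_add]
      congr 1
      rw [wdeg, Finsupp.weight_single, one_smul]
    rw [← PNat.coe_lt_coe]
    by_contra hlt
    have h0 : wdeg (k - Finsupp.single v 1) = 0 := by omega
    have hvd : v.1 = d := PNat.coe_injective (by omega)
    rw [wdeg_eq_zero_iff.1 h0, add_zero] at hdecomp
    exact hs (shape_eq_singleton_iff.2 ⟨v, hvd, by rw [← hdecomp, ← hsingle v hvd]; rfl⟩)

/-- Strong induction on `d` recovers the power sums: the correction `E⁺_{d^m} - M_{d^m}` lives in
rows below `d`, where all `M_τ` are already available. -/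
theorem adjoin_EplusStack :
    Algebra.adjoin ℚ (Set.range fun p : ℕ+ × ℕ+ => EplusStack p.1 p.2) = ⊤ := by
  set B := Algebra.adjoin ℚ (Set.range fun p : ℕ+ × ℕ+ => EplusStack p.1 p.2)
  have hp : ∀ d m : ℕ+, M (ofMultiset {toLex (d, m)}) ∈ B := by
    intro d
    induction d using PNat.strongInductionOn with
    | _ d ih =>
      intro m
      have hE : EplusStack d m ∈ B := Algebra.subset_adjoin ⟨(d, m), rfl⟩
      have hsub : EplusStack d m - M (ofMultiset {toLex (d, m)}) ∈ B := by
        refine mem_of_forall_shape_mem (Subalgebra.toSubmodule B) _ fun n hn => ?_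
        exact M_mem_of_powerSum_mem B (Set.Iio d) (fun s hs => ih s.deg hs s.mult) _ _ le_rfl
          (mem_shape_deg.2 (lt_of_coeff_EplusStack_sub_ne_zero hn))
      have := B.sub_mem hE hsub
      rwa [sub_sub_cancel] at this
  refine eq_top_iff.2 fun f _ => ?_
  refine mem_of_forall_shape_mem (Subalgebra.toSubmodule B) f fun n _ => ?_
  exact M_mem_of_powerSum_mem B Set.univ (fun s _ => hp s.deg s.mult) _ _ le_rfl (by simp)

/-! ### Linear and algebraic bases -/

/-- The product of the values of `F` at the parts of a stack partition. -/
def partsProd (F : ℕ+ × ℕ+ → PLambda) (τ : StackPartition) : PLambda :=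
  (τ.parts.map fun s => F (s.deg, s.mult)).prod

theorem partsProd_ofMultiset (F : ℕ+ × ℕ+ → PLambda) (μ : Multiset Stack) :
    partsProd F (ofMultiset μ) = (μ.map fun s => F (s.deg, s.mult)).prod := by
  rw [partsProd, ← Multiset.prod_coe, ← Multiset.map_coe, coe_parts_ofMultiset]

theorem map_partsProd (φ : PLambda →ₐ[ℚ] PLambda) (F : ℕ+ × ℕ+ → PLambda) (τ : StackPartition) :
    φ (partsProd F τ) = partsProd (φ ∘ F) τ := by
  rw [partsProd, partsProd, map_list_prod, List.map_map]
  rfl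

theorem linearIndependent_partsProd_comp {φ : PLambda →ₐ[ℚ] PLambda} (hφ : Function.Injective φ)
    {F : ℕ+ × ℕ+ → PLambda} (h : LinearIndependent ℚ (partsProd F)) :
    LinearIndependent ℚ (partsProd (φ ∘ F)) := by
  have hmap : partsProd (φ ∘ F) = φ.toLinearMap ∘ partsProd F :=
    funext fun τ => (map_partsProd φ F τ).symm
  rw [hmap]
  exact h.map_injOn φ.toLinearMap hφ.injOn

theorem span_partsProd {F : ℕ+ × ℕ+ → PLambda} (h : Algebra.adjoin ℚ (Set.range F) = ⊤) :
    Submodule.span ℚ (Set.range (partsProd F)) = ⊤ := by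
  have h' := Algebra.adjoin_eq_span (R := ℚ) (s := Set.range F)
  rw [h, Algebra.top_toSubmodule] at h'
  refine eq_top_iff.2 (h'.le.trans (Submodule.span_mono fun x hx => ?_))
  suffices ∃ μ : Multiset Stack, x = (μ.map fun s => F (s.deg, s.mult)).prod by
    obtain ⟨μ, rfl⟩ := this
    exact ⟨ofMultiset μ, partsProd_ofMultiset F μ⟩
  induction hx using Submonoid.closure_induction with
  | mem x hx =>
    obtain ⟨p, rfl⟩ := hx
    exact ⟨{toLex p}, by simp; rfl⟩
  | one => exact ⟨0, by simp⟩
  | mul x y _ _ hx hy =>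
    obtain ⟨μ, rfl⟩ := hx
    obtain ⟨ν, rfl⟩ := hy
    exact ⟨μ + ν, by simp⟩

/-- If the products of the `F_{d^m}` over stack partitions are linearly independent, then the
`F_{d^m}` are algebraically independent. -/
theorem algebraicIndependent_of_linearIndependent_partsProd {F : ℕ+ × ℕ+ → PLambda}
    (h : LinearIndependent ℚ (partsProd F)) : AlgebraicIndependent ℚ F := by
  classical
  -- Distinct monomials in the generators correspond to distinct multisets of stacks, so their
  -- values form a subfamily of the linearly independent products.
  let e : (ℕ+ × ℕ+ →₀ ℕ) → StackPartition := fun n =>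
    ofMultiset ((Finsupp.toMultiset n).map toLex)
  have he : Function.Injective e := by
    intro n n' hn
    have := (equivMultiset.symm.injective hn : _ = _)
    exact Multiset.toFinsupp.symm.injective (Multiset.map_injective toLex.injective this)
  have hmon : ∀ n, MvPolynomial.aeval F (MvPolynomial.basisMonomials (ℕ+ × ℕ+) ℚ n) =
      partsProd F (e n) := by
    intro n
    rw [MvPolynomial.coe_basisMonomials, MvPolynomial.aeval_monomial, map_one, one_mul,
      partsProd_ofMultiset, Multiset.map_map]
    change _ = ((Finsupp.toMultiset n).map F).prod
    rw [Finsupp.toMultiset_map, Finsupp.prod_toMultiset,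
      Finsupp.prod_mapDomain_index pow_zero pow_add]
  rw [algebraicIndependent_iff_injective_aeval]
  have hli : LinearIndependent ℚ
      ((MvPolynomial.aeval F).toLinearMap ∘ MvPolynomial.basisMonomials (ℕ+ × ℕ+) ℚ) := by
    have : ((MvPolynomial.aeval F).toLinearMap ∘ MvPolynomial.basisMonomials (ℕ+ × ℕ+) ℚ) =
        partsProd F ∘ e := funext hmon
    rw [this]
    exact h.comp e he
  have hrepr : ∀ q, MvPolynomial.aeval F q = Finsupp.linearCombination ℚ
      ((MvPolynomial.aeval F).toLinearMap ∘ MvPolynomial.basisMonomials (ℕ+ × ℕ+) ℚ)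
      ((MvPolynomial.basisMonomials (ℕ+ × ℕ+) ℚ).repr q) := by
    intro q
    rw [← Finsupp.apply_linearCombination, Module.Basis.linearCombination_repr]
    rfl
  intro q q' hq
  rw [hrepr, hrepr] at hq
  exact (MvPolynomial.basisMonomials (ℕ+ × ℕ+) ℚ).repr.injective (hli hq)

theorem wdeg_eq_of_coeff_EplusStack_ne_zero {d m : ℕ+} {n : Var →₀ ℕ}
    (h : MvPowerSeries.coeff n (EplusStack d m : MvPowerSeries Var ℚ) ≠ 0) :
    wdeg n = d * m := by
  classical
  obtain ⟨k, rfl⟩ := exists_smul_of_coeff_powVars_ne_zero h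
  rw [EplusStack, coeff_powVars_smul, coeff_Eplus, ne_eq, ite_eq_right_iff, not_forall] at h
  rw [map_nsmul, h.1.1, smul_eq_mul, mul_comm]

/-- The part of degree `n` of a polysymmetric function. -/
def degreeComponent (n : ℕ) : PLambda →ₗ[ℚ] MvPowerSeries Var ℚ :=
  (MvPowerSeries.weightedHomogeneousComponent (fun v : Var => (v.1 : ℕ)) n).comp
    PLambda.val.toLinearMap

theorem degreeComponent_eq {f : PLambda} {p : ℕ}
    (hf : MvPowerSeries.IsWeightedHomogeneous (fun v : Var => (v.1 : ℕ)) f.1 p) (n : ℕ) :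
    degreeComponent n f = if p = n then f.1 else 0 := by
  classical
  refine MvPowerSeries.ext fun k => ?_
  rw [degreeComponent, LinearMap.comp_apply, MvPowerSeries.coeff_weightedHomogeneousComponent]
  change (if _ then MvPowerSeries.coeff k f.1 else 0) = _
  by_cases hk : MvPowerSeries.coeff k f.1 = 0
  · split_ifs <;> simp [hk]
  · rw [hf hk]
    split_ifs <;> simp

theorem isWeightedHomogeneous_M (τ : StackPartition) :
    MvPowerSeries.IsWeightedHomogeneous (fun v : Var => (v.1 : ℕ)) (M τ).1 τ.size := by
  classical
  intro n hn
  rw [coeff_M, ne_eq, ite_eq_right_iff, not_forall] at hn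
  change wdeg n = _
  rw [← size_ofMultiset_shape, hn.1, ofMultiset_coe_parts]

theorem isWeightedHomogeneous_partsProd_EplusStack (τ : StackPartition) :
    MvPowerSeries.IsWeightedHomogeneous (fun v : Var => (v.1 : ℕ))
      (partsProd (fun p => EplusStack p.1 p.2) τ).1 τ.size := by
  classical
  rw [partsProd, size]
  induction τ.parts with
  | nil =>
    intro n hn
    simp only [List.map_nil, List.prod_nil, OneMemClass.coe_one, MvPowerSeries.coeff_one, ne_eq,
      ite_eq_right_iff, not_forall] at hn
    rw [hn.1]
    simp
  | cons s l ih =>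
    simp only [List.map_cons, List.prod_cons, List.sum_cons, MulMemClass.coe_mul]
    have hs : MvPowerSeries.IsWeightedHomogeneous (fun v : Var => (v.1 : ℕ))
        (EplusStack s.deg s.mult).1 (s.deg * s.mult) :=
      fun h => wdeg_eq_of_coeff_EplusStack_ne_zero h
    have hl : MvPowerSeries.IsWeightedHomogeneous (fun v : Var => (v.1 : ℕ))
        (l.map fun s => EplusStack s.deg s.mult).prod.1
        (l.map fun s => (s.deg : ℕ) * (s.mult : ℕ)).sum := fun h => ih h
    exact fun {_} h => hs.mul hl h

/-- A dimension count: the finitely many products of size `n` span a space containing equally many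
linearly independent elements `M_τ`. -/
theorem linearIndependent_partsProd_EplusStack_of_size (n : ℕ) :
    LinearIndependent ℚ fun τ : {τ : StackPartition // τ.size = n} =>
      (partsProd (fun p => EplusStack p.1 p.2) τ).1 := by
  have : Fintype {τ : StackPartition // τ.size = n} := (finite_size_eq n).fintype
  have hval : LinearMap.ker PLambda.val.toLinearMap = ⊥ :=
    LinearMap.ker_eq_bot.2 Subtype.val_injective
  have hM : LinearIndependent ℚ fun τ : {τ : StackPartition // τ.size = n} => (M τ).1 :=
    (linearIndependent_M.comp _ Subtype.val_injective).map' PLambda.val.toLinearMap hval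
  rw [linearIndependent_iff_card_le_finrank_span, ← finrank_span_eq_card hM]
  have hfin := FiniteDimensional.span_of_finite ℚ (Set.finite_range
    fun τ : {τ : StackPartition // τ.size = n} => (partsProd (fun p => EplusStack p.1 p.2) τ).1)
  refine Submodule.finrank_mono (Submodule.span_le.2 ?_)
  rintro _ ⟨⟨τ, hτ⟩, rfl⟩
  have htop : M τ ∈ Submodule.span ℚ
      (Set.range (partsProd fun p => EplusStack p.1 p.2)) := by
    rw [span_partsProd adjoin_EplusStack]
    trivial
  -- Projection to degree `n` fixes `M_τ` and the products of size `n`, and kills all other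
  -- products.
  have hmap := Submodule.mem_map_of_mem (f := degreeComponent n) htop
  rw [degreeComponent_eq (isWeightedHomogeneous_M τ), if_pos hτ, Submodule.map_span] at hmap
  refine Submodule.span_le.2 ?_ hmap
  rintro _ ⟨_, ⟨σ, rfl⟩, rfl⟩
  rw [degreeComponent_eq (isWeightedHomogeneous_partsProd_EplusStack σ)]
  split_ifs with h
  · exact Submodule.subset_span ⟨⟨σ, h⟩, rfl⟩
  · exact zero_mem _

/-- The products are homogeneous, so a relation splits into relations among products of one size. -/
theorem linearIndependent_partsProd_EplusStack :
    LinearIndependent ℚ (partsProd fun p => EplusStack p.1 p.2) := by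
  classical
  rw [linearIndependent_iff']
  intro s g hg τ hτ
  have h := congrArg (degreeComponent τ.size) hg
  simp only [map_sum, map_smul, map_zero,
    degreeComponent_eq (isWeightedHomogeneous_partsProd_EplusStack _), smul_ite, smul_zero] at h
  rw [← Finset.sum_filter] at h
  have hli := linearIndependent_iff'.1 (linearIndependent_partsProd_EplusStack_of_size τ.size)
    (s.subtype fun σ => σ.size = τ.size) (fun σ => g σ)
    (by rw [← h, ← Finset.sum_subtype_eq_sum_filter])
  exact hli ⟨τ, rfl⟩ (Finset.mem_subtype.2 hτ)

theorem algebraicIndependent_EplusStack :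
    AlgebraicIndependent ℚ fun p : ℕ+ × ℕ+ => EplusStack p.1 p.2 :=
  algebraicIndependent_of_linearIndependent_partsProd linearIndependent_partsProd_EplusStack

/-! ### The involution -/

/-- The isomorphism of `PΛ` with the polynomial ring in the `E⁺_{d^m}`. -/
def EplusStackEquiv : MvPolynomial (ℕ+ × ℕ+) ℚ ≃ₐ[ℚ] PLambda :=
  AlgEquiv.ofBijective (MvPolynomial.aeval fun p : ℕ+ × ℕ+ => EplusStack p.1 p.2)
    ⟨algebraicIndependent_EplusStack, by
      rw [← AlgHom.range_eq_top, ← Algebra.adjoin_range_eq_range_aeval, adjoin_EplusStack]⟩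

/-- The endomorphism of `PΛ` that sends `E⁺_{d^m}` to `H⁺_{d^m}`. -/
def omega : PLambda →ₐ[ℚ] PLambda :=
  (MvPolynomial.aeval fun p : ℕ+ × ℕ+ => HplusStack p.1 p.2).comp
    EplusStackEquiv.symm.toAlgHom

theorem omega_EplusStack (d m : ℕ+) : omega (EplusStack d m) = HplusStack d m := by
  have h : EplusStackEquiv (MvPolynomial.X (d, m)) = EplusStack d m :=
    MvPolynomial.aeval_X _ _
  rw [← h, omega, AlgHom.comp_apply]
  change MvPolynomial.aeval _ (EplusStackEquiv.symm (EplusStackEquiv _)) = _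
  rw [AlgEquiv.symm_apply_apply, MvPolynomial.aeval_X]

theorem Eplus_zero : Eplus 0 = 1 := by
  classical
  refine Subtype.ext (MvPowerSeries.ext (R := ℚ) fun n : Var →₀ ℕ => ?_)
  rw [coeff_Eplus, OneMemClass.coe_one, MvPowerSeries.coeff_one]
  refine if_congr ⟨fun h => wdeg_eq_zero_iff.1 h.1, ?_⟩ rfl rfl
  rintro rfl
  simp

theorem Hplus_zero : Hplus 0 = 1 := by
  have h := congrArg (PowerSeries.coeff 0) mk_Eplus_mul_mk_Hplus
  simpa [PowerSeries.coeff_mul, Eplus_zero] using h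

/-- Applying `Ω` to `E H = 1` gives `H · Ω(H) = 1`, so `Ω(H)` and `E` are both inverse to `H`. -/
theorem omega_HplusStack (d m : ℕ+) : omega (HplusStack d m) = EplusStack d m := by
  set E : PowerSeries PLambda := PowerSeries.mk fun k => powVars m (Eplus k) with hE
  set H : PowerSeries PLambda := PowerSeries.mk fun k => powVars m (Hplus k) with hH
  have hEH : E * H = 1 := by
    have h := congrArg (PowerSeries.map (powVars m : PLambda →+* PLambda)) mk_Eplus_mul_mk_Hplus
    rwa [map_mul, map_one] at h
  have hmap : PowerSeries.map (omega : PLambda →+* PLambda) E = H := by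
    ext k : 1
    rw [PowerSeries.coeff_map, hE, hH, PowerSeries.coeff_mk, PowerSeries.coeff_mk]
    -- `Ω` is prescribed only for positive `d`; the constant terms are both `1`.
    rcases Nat.eq_zero_or_pos k with rfl | hk
    · simp [Eplus_zero, Hplus_zero]
    · exact omega_EplusStack ⟨k, hk⟩ m
  have hH' : H * PowerSeries.map (omega : PLambda →+* PLambda) H = 1 := by
    rw [← hmap, ← map_mul, hmap, hEH, map_one]
  have h := congrArg (PowerSeries.coeff (d : ℕ)) (left_inv_eq_right_inv hEH hH')
  rw [PowerSeries.coeff_map, hE, hH, PowerSeries.coeff_mk, PowerSeries.coeff_mk] at h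
  exact h.symm

theorem omega_involutive : Function.Involutive omega := by
  have h : omega.comp omega = AlgHom.id ℚ PLambda := by
    refine AlgHom.ext_of_adjoin_eq_top adjoin_EplusStack ?_
    rintro _ ⟨p, rfl⟩
    simp only [AlgHom.comp_apply, omega_EplusStack, omega_HplusStack, AlgHom.id_apply]
  exact fun f => DFunLike.congr_fun h f

end Polysymmetric

/-! ### The theorem and its corollary -/

open Polysymmetric in
theorem mainTheorem1 :
    -- there is exactly one ring endomorphism with the prescribed values, and it is an involution
    (∃ Ω : Polysymmetric.PLambda →+* Polysymmetric.PLambda,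
      (∀ d m : ℕ+, Ω (Polysymmetric.EplusStack d m) = Polysymmetric.HplusStack d m) ∧
      (∀ Ω' : Polysymmetric.PLambda →+* Polysymmetric.PLambda,
        (∀ d m : ℕ+, Ω' (Polysymmetric.EplusStack d m) = Polysymmetric.HplusStack d m) →
          Ω' = Ω) ∧
      Function.Involutive Ω) ∧
    -- algebraic basis: algebraically independent generators
    (AlgebraicIndependent ℚ (fun p : ℕ+ × ℕ+ => Polysymmetric.HplusStack p.1 p.2) ∧
      Algebra.adjoin ℚ
        (Set.range fun p : ℕ+ × ℕ+ => Polysymmetric.HplusStack p.1 p.2) = ⊤) ∧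
    -- linear basis: linearly independent spanning family
    (LinearIndependent ℚ Polysymmetric.HplusPartition ∧
      Submodule.span ℚ (Set.range Polysymmetric.HplusPartition) = ⊤) := by
  have hinj : Function.Injective omega := omega_involutive.injective
  have hcomp : (omega ∘ fun p : ℕ+ × ℕ+ => EplusStack p.1 p.2) =
      fun p : ℕ+ × ℕ+ => HplusStack p.1 p.2 :=
    funext fun p => omega_EplusStack p.1 p.2
  have hadj : Algebra.adjoin ℚ (Set.range fun p : ℕ+ × ℕ+ => HplusStack p.1 p.2) = ⊤ := by
    rw [← hcomp, Set.range_comp, ← AlgHom.map_adjoin, adjoin_EplusStack, Algebra.map_top,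
      AlgHom.range_eq_top]
    exact omega_involutive.surjective
  have hpart : partsProd (omega ∘ fun p : ℕ+ × ℕ+ => EplusStack p.1 p.2) = HplusPartition := by
    rw [hcomp]
    rfl
  refine ⟨⟨omega, omega_EplusStack, fun Ω' h => ?_, omega_involutive⟩, ⟨?_, hadj⟩, ?_, ?_⟩
  -- A ring endomorphism of a `ℚ`-algebra is automatically `ℚ`-linear, so it is determined by its
  -- values on algebra generators.
  · have : Ω'.toRatAlgHom = omega := by
      refine AlgHom.ext_of_adjoin_eq_top adjoin_EplusStack ?_
      rintro _ ⟨p, rfl⟩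
      exact (h p.1 p.2).trans (omega_EplusStack p.1 p.2).symm
    ext1 f
    exact DFunLike.congr_fun this f
  · rw [← hcomp]
    exact algebraicIndependent_EplusStack.map' hinj
  · exact hpart ▸ linearIndependent_partsProd_comp hinj linearIndependent_partsProd_EplusStack
  · exact span_partsProd (F := fun p : ℕ+ × ℕ+ => HplusStack p.1 p.2) hadj

end
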